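/- Let $A\ge 2$ be an integer, let $b=-A+i$ or $b=-A-i$, and let $\tau\ge 2$ and $\lambda>0$ be real numbers. Put \[ n_0=n_0(\lambda,\tau):=1+\max\left\{0,\ \left\lfloor\frac{\log(3/\lambda)}{\log\tau}\right\rfloor,\ \frac{\log 3}{\log|b|}\right\}. \] Then the series \[ \xi(\tau,\lambda):=\sum_{n\ge n_0}\frac{1}{b^{\lfloor\lambda\tau^n\rfloor}} \] over the integers $n\ge n_0$ converges absolutely, its sum is of the form $\sum_{j\ge1}d_jb^{-j}$ with all digits $d_j\in\{0,1\}$, the number $\xi(\tau,\lambda)$ does not lie in $\mathbb{Q}(i)$, and its irrationality exponent with respect to $\mathbb{Q}(i)$ is \[ \sup\left\{\mu\in\mathbb{R}:\ \left|\xi(\tau,\lambda)-\frac pq\right|<\frac1{|q|^{\mu}}\ \text{ for infinitely many numbers } \frac pq\in\mathbb{Q}(i),\ p,q\in\mathbb{Z}[i],\ q\ne0\right\}=\tau . \] Furthermore, when $\tau=2$, the number $\xi(\tau,\lambda)$ is badly approximable: there is a constant $c>0$ such that $\left|\xi(\tau,\lambda)-\frac pq\right|\ge\frac{c}{|q|^2}$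 for all $p,q\in\mathbb{Z}[i]$ with $q\ne0$. -/

import Mathlib

noncomputable section

/-- The field `ℚ(i)`, as the set of all quotients of Gaussian integers in `ℂ`. -/
def gaussianRationals : Set ℂ :=
  {z : ℂ | ∃ p q : GaussianInt, q ≠ 0 ∧ z = (p : ℂ) / (q : ℂ)}

/-- The real numbers `m` such that `|ξ - p/q| < 1/|q|^m` for infinitely many numbers
`p/q ∈ ℚ(i)`. -/
def gaussianApproxExponents (ξ : ℂ) : Set ℝ :=
  {m : ℝ | {z : ℂ | ∃ p q : GaussianInt, q ≠ 0 ∧ z = (p : ℂ) / (q : ℂ) ∧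
    ‖ξ - (p : ℂ) / (q : ℂ)‖ < 1 / ‖(q : ℂ)‖ ^ m}.Infinite}

/-- The irrationality exponent of `ξ` with respect to `ℚ(i)`: the supremum, in the extended reals,
of the admissible exponents. -/
def gaussianIrrationalityExponent (ξ : ℂ) : EReal :=
  sSup ((fun m : ℝ => (m : EReal)) '' gaussianApproxExponents ξ)

/-- `ξ ∈ ℂ \ ℚ(i)` is badly approximable if `|ξ - p/q| ≥ c/|q|²` for some `c > 0` and all
Gaussian integers `p` and `q ≠ 0`. -/
def GaussianBadlyApproximable (ξ : ℂ) : Prop :=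
  ξ ∉ gaussianRationals ∧
    ∃ c : ℝ, 0 < c ∧ ∀ p q : GaussianInt, q ≠ 0 →
      c / ‖(q : ℂ)‖ ^ 2 ≤ ‖ξ - (p : ℂ) / (q : ℂ)‖

/-- The complex numbers `∑_{j ≥ 1} d_j b^{-j}` with all digits `d_j` in `J`. -/
def digitSet (b : ℂ) (J : Set ℕ) : Set ℂ :=
  {ζ : ℂ | ∃ d : ℕ → ℕ, (∀ j, d j ∈ J) ∧ HasSum (fun j : ℕ => (d j : ℂ) / b ^ (j + 1)) ζ}

/-- `n₀ = 1 + max {0, ⌊log (3/λ) / log τ⌋, log 3 / log |b|}`, a real number. -/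
def startIndex (b : ℂ) (τ lam : ℝ) : ℝ :=
  1 + max (max 0 (⌊Real.log (3 / lam) / Real.log τ⌋ : ℝ)) (Real.log 3 / Real.log ‖b‖)

/-- The terms `1 / b^⌊λ τⁿ⌋`, for the natural numbers `n ≥ n₀`. -/
def lacunaryTerm (b : ℂ) (τ lam : ℝ) (n : {n : ℕ // startIndex b τ lam ≤ (n : ℝ)}) : ℂ :=
  1 / b ^ ⌊lam * τ ^ (n : ℕ)⌋₊

/-- `ξ(τ, λ) = ∑_{n ≥ n₀} 1 / b^⌊λ τⁿ⌋`. -/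
def lacunaryNumber (b : ℂ) (τ lam : ℝ) : ℂ :=
  ∑' n, lacunaryTerm b τ lam n

end

/-!
The exponents `e k = ⌊λ τ ^ (N + k)⌋` with `N = ⌈n₀⌉` start at `3` or later and satisfy
`e (k + 1) ≥ 2 e k`. Hence the partial sums of the series are reduced fractions `P / Q` with
`Q = b ^ e k`, and the next one is

  `P / Q + 1 / (Q ^ 2 x) = (P Q x + 1) / (Q ^ 2 x)`, with `x = b ^ (e (k + 1) - 2 e k)`.

This is the situation of the folding lemma for continued fractions. Instead of continued fractions,
the proof uses the lattice `{(q, s) : s ≡ q P mod Q}` in `ℤ[i] ^ 2`, whose vectors are the pairs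
`(q, Q (q P / Q - p))`. The symmetry of the folded continued fraction becomes the congruence
`(P Q x + 1) (1 - P Q x) ≡ 1 mod Q ^ 2 x`: exchanging the two coordinates turns the lattice of the
next partial sum into that of `-P / Q + 1 / (Q ^ 2 x)`.

The claim is that `|q| |s| ≥ c m ^ (2 - τ) |Q|` with `m = min |q| |s|` for all vectors with nonzero
coordinates, with `c > 0` independent of the partial sum. In the passage to the next one, a vector
with both coordinates at least `|Q| / 4` satisfies it because `|x|` is at most a constant times
`|Q| ^ (τ - 2)`. A vector with a smaller coordinate comes, after an exchange of the coordinates if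
necessary, from a vector `(u, v)` of the present lattice, as `(u, Q x v ± u)`, and `|u| |v| / |Q|`
changes only by a relative error of at most `|u| / |Q v|`. Strengthening the claim by the factors
`1 + 4 / |Q|` and `1 + 1 / m` makes it hereditary (`gapWeight_step`, `HyperbolicGap.fold`).

In the limit, `|ξ - p / q| ≥ c / |q| ^ τ` for all `p` and `q ≠ 0`
(`IsDoubling.exists_le_norm_sub`). This gives the irrationality of `ξ`, the upper bound `τ` for its
irrationality exponent, and bad approximability for `τ = 2`. The partial sums themselves, with error
at most `2 / |b| ^ e (k + 1)`, show that the exponent is at least `τ`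
(`IsDoubling.gaussianIrrationalityExponent_eq`).
-/

/-! ### Norms of Gaussian integers -/

lemma one_le_norm_toComplex {q : GaussianInt} (hq : q ≠ 0) : 1 ≤ ‖(q : ℂ)‖ := by
  have h1 : (1 : ℤ) ≤ q.norm := by
    have := GaussianInt.norm_pos.2 hq
    omega
  have h2 : (1 : ℝ) ≤ ‖(q : ℂ)‖ ^ 2 := by
    rw [← Complex.normSq_eq_norm_sq, ← GaussianInt.intCast_real_norm]
    exact_mod_cast h1
  nlinarith [norm_nonneg (q : ℂ)]

lemma toComplex_ne_zero {q : GaussianInt} (hq : q ≠ 0) : (q : ℂ) ≠ 0 :=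
  fun h => hq (GaussianInt.toComplex_eq_zero.1 h)

lemma norm_toComplex_le_of_dvd {q r : GaussianInt} (hr : r ≠ 0) (h : q ∣ r) :
    ‖(q : ℂ)‖ ≤ ‖(r : ℂ)‖ := by
  obtain ⟨t, rfl⟩ := h
  have ht : t ≠ 0 := right_ne_zero_of_mul hr
  rw [map_mul, norm_mul]
  exact le_mul_of_one_le_right (norm_nonneg _) (one_le_norm_toComplex ht)

lemma finite_norm_toComplex_le (R : ℝ) : {q : GaussianInt | ‖(q : ℂ)‖ ≤ R}.Finite := by
  have hfin : ((Set.Icc (-⌈R⌉) ⌈R⌉) ×ˢ (Set.Icc (-⌈R⌉) ⌈R⌉)).Finite :=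
    (Set.finite_Icc _ _).prod (Set.finite_Icc _ _)
  refine Set.Finite.of_finite_image (f := fun q : GaussianInt => (q.re, q.im))
    (hfin.subset ?_) ?_
  · rintro _ ⟨q, hq, rfl⟩
    have hq : ‖(q : ℂ)‖ ≤ R := hq
    have h1 := (Complex.abs_re_le_norm (q : ℂ)).trans (hq.trans (Int.le_ceil R))
    have h2 := (Complex.abs_im_le_norm (q : ℂ)).trans (hq.trans (Int.le_ceil R))
    rw [← GaussianInt.intCast_re] at h1
    rw [← GaussianInt.intCast_im] at h2
    have h1' : |q.re| ≤ ⌈R⌉ := by exact_mod_cast h1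
    have h2' : |q.im| ≤ ⌈R⌉ := by exact_mod_cast h2
    exact ⟨abs_le.1 h1', abs_le.1 h2'⟩
  · intro q _ r _ h
    simp only [Prod.mk.injEq] at h
    exact Zsqrtd.ext h.1 h.2

/-! ### The real inequalities behind the folding step -/

/-- The lower bound required of `|q| |s|`, for a lattice vector `(q, s)` at a denominator of norm
`Q`, where `m = min |q| |s|`. Up to a factor between `c` and `4 c` (if `m ≥ 1` and `Q ≥ 4`) it is
`m ^ (-σ) * Q`. The two decreasing factors `1 + 4 / Q` and `1 + 1 / m` pay for the error made in
each folding step, so that the constant `c` is the same at all levels. -/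
noncomputable def gapWeight (σ c Q m : ℝ) : ℝ := c * (1 + 4 / Q) * (1 + 1 / m) * m ^ (-σ) * Q

/-- Passage of the bound from a vector `(u, v)` with short first coordinate, at denominator `Q`, to
the vector `(u, w)`, at denominator `Q ^ 2 * X`. The relative loss is `u / (Q v)`. If `u ≤ 2 v`, it
is at most `2 / Q` and is covered by the growth of the denominator. If `u ≥ 2 v`, it is at most
`1 / (4 v)`, and is covered because the smaller coordinate grows from `v` to at least `2 v`. -/
lemma gapWeight_step {σ c Q X u v w : ℝ} (hσ : 0 ≤ σ) (hc : 0 ≤ c) (hQ : 8 ≤ Q) (hX : 1 ≤ X)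
    (hu : 1 ≤ u) (hv : 1 ≤ v) (huQ : u ≤ Q / 4) (hw : Q * X * v - u ≤ w)
    (h : gapWeight σ c Q (min u v) ≤ u * v) :
    gapWeight σ c (Q ^ 2 * X) (min u w) ≤ u * w := by
  have hQ0 : 0 < Q := by linarith
  have hX0 : 0 < X := by linarith
  have hu0 : 0 < u := by linarith
  have hv0 : 0 < v := by linarith
  have hm0 : 0 < min u v := lt_min hu0 hv0
  have hXv : 1 ≤ X * v := one_le_mul_of_one_le_of_one_le hX hv
  have huw : u ≤ w := by nlinarith
  rw [min_eq_left huw]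
  have hrel : (1 + 4 / (Q ^ 2 * X)) * (1 + 1 / u) ≤
      (1 + 4 / Q) * (1 + 1 / min u v) * (1 - u / (Q * v)) := by
    have hQ1 : 4 / (Q ^ 2 * X) ≤ 4 / Q ^ 2 := by
      apply div_le_div_of_nonneg_left <;> nlinarith [sq_nonneg Q]
    rcases le_total u (2 * v) with h2 | h2
    · have e1 : u / (Q * v) ≤ 2 / Q := by
        rw [div_le_div_iff₀ (by positivity) hQ0]; nlinarith
      have e2 : 1 + 1 / u ≤ 1 + 1 / min u v := by
        have := one_div_le_one_div_of_le hm0 (min_le_left u v); linarith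
      have e3 : 1 + 4 / Q ^ 2 ≤ (1 + 4 / Q) * (1 - 2 / Q) := by
        have : (1 + 4 / Q) * (1 - 2 / Q) - (1 + 4 / Q ^ 2) = (2 * Q - 12) / Q ^ 2 := by
          field_simp; ring
        have : 0 ≤ (2 * Q - 12) / Q ^ 2 := div_nonneg (by linarith) (by positivity)
        linarith
      calc (1 + 4 / (Q ^ 2 * X)) * (1 + 1 / u)
          ≤ (1 + 4 / Q ^ 2) * (1 + 1 / min u v) := by gcongr
        _ ≤ ((1 + 4 / Q) * (1 - 2 / Q)) * (1 + 1 / min u v) := by gcongr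
        _ = (1 + 4 / Q) * (1 + 1 / min u v) * (1 - 2 / Q) := by ring
        _ ≤ _ := by gcongr
    · rw [min_eq_right (by linarith)]
      have e1 : u / (Q * v) ≤ 1 / (4 * v) := by
        rw [div_le_div_iff₀ (by positivity) (by positivity)]; nlinarith
      have e2 : 1 + 1 / u ≤ (1 + 1 / v) * (1 - 1 / (4 * v)) := by
        have h3 : 1 / u ≤ 1 / (2 * v) := one_div_le_one_div_of_le (by positivity) h2
        have : (1 + 1 / v) * (1 - 1 / (4 * v)) - (1 + 1 / (2 * v)) = (v - 1) / (4 * v ^ 2) := by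
          field_simp; ring
        have : 0 ≤ (v - 1) / (4 * v ^ 2) := div_nonneg (by linarith) (by positivity)
        linarith
      have e3 : 4 / Q ^ 2 ≤ 4 / Q := by
        apply div_le_div_of_nonneg_left <;> nlinarith
      calc (1 + 4 / (Q ^ 2 * X)) * (1 + 1 / u)
          ≤ (1 + 4 / Q) * ((1 + 1 / v) * (1 - 1 / (4 * v))) := by
            apply mul_le_mul _ e2 (by positivity) (by positivity); linarith
        _ = (1 + 4 / Q) * (1 + 1 / v) * (1 - 1 / (4 * v)) := by ring
        _ ≤ _ := by gcongr
  have hpow : u ^ (-σ) ≤ (min u v) ^ (-σ) :=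
    Real.rpow_le_rpow_of_nonpos hm0 (min_le_left u v) (by linarith)
  have hr : 0 ≤ 1 - u / (Q * v) := by
    rw [sub_nonneg, div_le_one (by positivity)]; nlinarith
  have hpu : 0 ≤ u ^ (-σ) := by positivity
  calc gapWeight σ c (Q ^ 2 * X) u
      = ((1 + 4 / (Q ^ 2 * X)) * (1 + 1 / u)) * u ^ (-σ) * (c * (Q * X * Q)) := by
        unfold gapWeight; ring
    _ ≤ ((1 + 4 / Q) * (1 + 1 / min u v) * (1 - u / (Q * v))) * (min u v) ^ (-σ)
          * (c * (Q * X * Q)) := by gcongr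
    _ = gapWeight σ c Q (min u v) * (Q * X * (1 - u / (Q * v))) := by unfold gapWeight; ring
    _ ≤ (u * v) * (Q * X * (1 - u / (Q * v))) := by gcongr
    _ = u * (Q * X * v - X * u) := by field_simp
    _ ≤ u * w := by
      apply mul_le_mul_of_nonneg_left _ hu0.le
      nlinarith

/-- A vector both of whose coordinates are at least `Q / 4` satisfies the bound at denominator
`Q ^ 2 * X`, whatever happens at denominator `Q`. -/
lemma gapWeight_le_mul_of_large {σ c Q X u w : ℝ} (hσ : 0 ≤ σ) (hc : 0 ≤ c) (hQ : 8 ≤ Q)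
    (hX : 1 ≤ X) (hu : 1 ≤ u) (hw : 1 ≤ w) (huQ : Q / 4 ≤ u) (hwQ : Q / 4 ≤ w)
    (hcX : 64 * c * 4 ^ σ * X ≤ Q ^ σ) :
    gapWeight σ c (Q ^ 2 * X) (min u w) ≤ u * w := by
  have hQ0 : 0 < Q := by linarith
  have hm1 : 1 ≤ min u w := le_min hu hw
  have hmQ : Q / 4 ≤ min u w := le_min huQ hwQ
  have e1 : 1 + 1 / min u w ≤ 2 := by
    have : 1 / min u w ≤ 1 := by rw [div_le_one (by linarith)]; exact hm1
    linarith
  have e2 : 1 + 4 / (Q ^ 2 * X) ≤ 2 := by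
    have : 4 / (Q ^ 2 * X) ≤ 1 := by rw [div_le_one (by positivity)]; nlinarith [sq_nonneg Q]
    linarith
  have e3 : (min u w) ^ (-σ) ≤ 4 ^ σ / Q ^ σ := by
    calc (min u w) ^ (-σ) ≤ (Q / 4) ^ (-σ) :=
          Real.rpow_le_rpow_of_nonpos (by positivity) hmQ (by linarith)
      _ = 4 ^ σ / Q ^ σ := by
          rw [Real.rpow_neg (by positivity), Real.div_rpow hQ0.le (by norm_num), inv_div]
  have hQσ : 0 < Q ^ σ := Real.rpow_pos_of_pos hQ0 σ
  calc gapWeight σ c (Q ^ 2 * X) (min u w)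
      ≤ c * 2 * 2 * (4 ^ σ / Q ^ σ) * (Q ^ 2 * X) := by unfold gapWeight; gcongr
    _ = (64 * c * 4 ^ σ * X) / Q ^ σ * (Q / 4 * (Q / 4)) := by field_simp; ring
    _ ≤ 1 * (Q / 4 * (Q / 4)) := by
        gcongr
        rwa [div_le_one hQσ]
    _ ≤ u * w := by rw [one_mul]; gcongr

/-! ### The folding step for lattices of Gaussian integers -/

/-- All vectors of the lattice `{(q, s) : s ≡ q P mod Q}` with nonzero coordinates satisfy the lower
bound `gapWeight` for `|q| |s|`. Since `s = Q (q P / Q - p)` for a Gaussian integer `p`, this is a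
statement on the quality of the rational approximations `p / q` to `P / Q`. -/
def HyperbolicGap (σ c : ℝ) (P Q : GaussianInt) : Prop :=
  ∀ q s : GaussianInt, q ≠ 0 → s ≠ 0 → Q ∣ s - q * P →
    gapWeight σ c ‖(Q : ℂ)‖ (min ‖(q : ℂ)‖ ‖(s : ℂ)‖) ≤ ‖(q : ℂ)‖ * ‖(s : ℂ)‖

/-- The folding step, from `P / Q` to `P / Q + 1 / (Q ^ 2 * x)`. A vector with a coordinate of norm
at most `|Q| / 4` comes from the lattice of `P / Q`, directly if it is the first coordinate and
after an exchange of the coordinates if it is the second. -/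
lemma HyperbolicGap.fold {σ c : ℝ} {P Q x : GaussianInt} (h : HyperbolicGap σ c P Q)
    (hσ : 0 ≤ σ) (hc : 0 ≤ c) (hPQ : IsCoprime P Q) (hQ : 8 ≤ ‖(Q : ℂ)‖) (hx : x ≠ 0)
    (hcx : 64 * c * 4 ^ σ * ‖(x : ℂ)‖ ≤ ‖(Q : ℂ)‖ ^ σ) :
    HyperbolicGap σ c (P * Q * x + 1) (Q ^ 2 * x) := by
  have hX := one_le_norm_toComplex hx
  -- If the second coordinate of a vector in the lattice of `P / Q` vanishes, then `Q` divides the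
  -- first one, by coprimality, and the first one is not short.
  have hne : ∀ u v : GaussianInt, u ≠ 0 → ‖(u : ℂ)‖ ≤ ‖(Q : ℂ)‖ / 4 → Q ∣ v - u * P → v ≠ 0 := by
    rintro u v hu hle hdvd rfl
    have h1 : Q ∣ u * P := by simpa using hdvd
    have h2 := norm_toComplex_le_of_dvd hu (hPQ.symm.dvd_of_dvd_mul_right h1)
    linarith
  have hstep : ∀ u v w : GaussianInt, u ≠ 0 → ‖(u : ℂ)‖ ≤ ‖(Q : ℂ)‖ / 4 → Q ∣ v - u * P →
      (w = Q * x * v + u ∨ w = u - Q * x * v) →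
      gapWeight σ c ‖((Q ^ 2 * x : GaussianInt) : ℂ)‖ (min ‖(u : ℂ)‖ ‖(w : ℂ)‖) ≤
        ‖(u : ℂ)‖ * ‖(w : ℂ)‖ := by
    intro u v w hu hle hdvd hw
    have hv := hne u v hu hle hdvd
    have hn : ‖((Q ^ 2 * x : GaussianInt) : ℂ)‖ = ‖(Q : ℂ)‖ ^ 2 * ‖(x : ℂ)‖ := by simp
    rw [hn]
    refine gapWeight_step hσ hc hQ hX (one_le_norm_toComplex hu) (one_le_norm_toComplex hv) hle ?_
      (h u v hu hv hdvd)
    rw [sub_le_iff_le_add, ← norm_mul, ← norm_mul]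
    rcases hw with rfl | rfl
    · have := norm_sub_le ((Q : ℂ) * x * v + u) u
      simpa using this
    · have := norm_sub_le (u : ℂ) ((u : ℂ) - (Q : ℂ) * x * v)
      rw [sub_sub_cancel] at this
      simpa [add_comm] using this
  intro q s hq hs hdvd
  obtain ⟨t, ht⟩ := hdvd
  rcases le_total ‖(q : ℂ)‖ (‖(Q : ℂ)‖ / 4) with hq4 | hq4
  · refine hstep q (q * P + Q * t) s hq hq4 ⟨t, by ring⟩ (Or.inl ?_)
    linear_combination ht
  rcases le_total ‖(s : ℂ)‖ (‖(Q : ℂ)‖ / 4) with hs4 | hs4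
  · -- Modulo `Q ^ 2 * x` the inverse of `P * Q * x + 1` is `1 - P * Q * x`, so exchanging the two
    -- coordinates gives the lattice of the mirrored fraction.
    rw [min_comm, mul_comm ‖(q : ℂ)‖]
    refine hstep s (s * P + Q * (t - t * P * Q * x - q * P ^ 2 * x)) q hs hs4
      ⟨t - t * P * Q * x - q * P ^ 2 * x, by ring⟩ (Or.inr ?_)
    linear_combination (P * Q * x - 1) * ht
  · have hn : ‖((Q ^ 2 * x : GaussianInt) : ℂ)‖ = ‖(Q : ℂ)‖ ^ 2 * ‖(x : ℂ)‖ := by simp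
    rw [hn]
    exact gapWeight_le_mul_of_large hσ hc hQ hX (one_le_norm_toComplex hq)
      (one_le_norm_toComplex hs) hq4 hs4 hcx

/-! ### Series over at least doubling exponents -/

/-- The numerator of the partial sum `∑ j ≤ k, 1 / β ^ e j` over the denominator `β ^ e k`, for an
increasing sequence `e`. -/
def truncationNum (β : GaussianInt) (e : ℕ → ℕ) : ℕ → GaussianInt
  | 0 => 1
  | k + 1 => truncationNum β e k * β ^ (e (k + 1) - e k) + 1

/-- The sequence `e` at least doubles in each step, which makes the passage from one partial sum of
`∑ 1 / β ^ e k` to the next a folding step, and starts at `3` or later, which makes all denominators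
have norm at least `8` if `‖β‖ ≥ 2`. -/
structure IsDoubling (e : ℕ → ℕ) : Prop where
  three_le_zero : 3 ≤ e 0
  two_mul_le : ∀ k, 2 * e k ≤ e (k + 1)

namespace IsDoubling

variable {e : ℕ → ℕ} (he : IsDoubling e)
include he

lemma three_le (k : ℕ) : 3 ≤ e k := by
  induction k with
  | zero => exact he.three_le_zero
  | succ k ih => have := he.two_mul_le k; omega

lemma strictMono : StrictMono e :=
  strictMono_nat_of_lt_succ fun k => by
    have := he.two_mul_le k
    have := he.three_le k
    omega

lemma add_le (k j : ℕ) : e k + j ≤ e (k + j) := by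
  induction j with
  | zero => simp
  | succ j ih =>
    have : e (k + j) < e (k + (j + 1)) := he.strictMono (by omega)
    omega

lemma tendsto_atTop : Filter.Tendsto e Filter.atTop Filter.atTop :=
  he.strictMono.tendsto_atTop

variable {β : GaussianInt}

lemma truncationNum_div (hβ : β ≠ 0) (k : ℕ) :
    (truncationNum β e k : ℂ) / ((β ^ e k : GaussianInt) : ℂ) =
      ∑ j ∈ Finset.range (k + 1), 1 / (β : ℂ) ^ e j := by
  have hβ' := toComplex_ne_zero hβ
  induction k with
  | zero => simp [truncationNum]
  | succ k ih =>
    have h1 : (β : ℂ) ^ e (k + 1) = (β : ℂ) ^ (e (k + 1) - e k) * (β : ℂ) ^ e k := by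
      rw [← pow_add, Nat.sub_add_cancel (he.strictMono (Nat.lt_succ_self k)).le]
    rw [Finset.sum_range_succ, ← ih]
    simp only [truncationNum, map_add, map_mul, map_pow, map_one]
    rw [h1]
    field_simp

lemma isCoprime_truncationNum (k : ℕ) : IsCoprime (truncationNum β e k) (β ^ e k) := by
  apply IsCoprime.pow_right
  cases k with
  | zero => exact isCoprime_one_left
  | succ k =>
    obtain ⟨d, hd⟩ := Nat.exists_eq_succ_of_ne_zero
      (Nat.sub_pos_of_lt (he.strictMono (Nat.lt_succ_self k))).ne'
    refine ⟨1, -(truncationNum β e k * β ^ d), ?_⟩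
    simp only [truncationNum]
    rw [hd, pow_succ]
    ring

lemma eight_le_norm (hβ : 2 ≤ ‖(β : ℂ)‖) (k : ℕ) : 8 ≤ ‖((β ^ e k : GaussianInt) : ℂ)‖ := by
  rw [map_pow, norm_pow]
  calc (8 : ℝ) = 2 ^ 3 := by norm_num
    _ ≤ ‖(β : ℂ)‖ ^ 3 := by gcongr
    _ ≤ ‖(β : ℂ)‖ ^ e k := pow_le_pow_right₀ (by linarith) (he.three_le k)

lemma norm_one_div_pow_le (hβ : 2 ≤ ‖(β : ℂ)‖) (k j : ℕ) :
    ‖1 / (β : ℂ) ^ e (k + j)‖ ≤ 1 / ‖(β : ℂ)‖ ^ e k * (1 / 2) ^ j := by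
  rw [norm_div, norm_one, norm_pow, one_div_pow, one_div_mul_one_div]
  apply one_div_le_one_div_of_le (by positivity)
  calc ‖(β : ℂ)‖ ^ e k * 2 ^ j ≤ ‖(β : ℂ)‖ ^ e k * ‖(β : ℂ)‖ ^ j := by gcongr
    _ = ‖(β : ℂ)‖ ^ (e k + j) := (pow_add _ _ _).symm
    _ ≤ ‖(β : ℂ)‖ ^ e (k + j) := pow_le_pow_right₀ (by linarith) (he.add_le k j)

lemma summable (hβ : 2 ≤ ‖(β : ℂ)‖) : Summable fun k => 1 / (β : ℂ) ^ e k := by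
  refine Summable.of_norm_bounded (summable_geometric_two.mul_left (1 / ‖(β : ℂ)‖ ^ e 0))
    fun j => ?_
  simpa using he.norm_one_div_pow_le hβ 0 j

lemma tendsto_truncation (hβ : 2 ≤ ‖(β : ℂ)‖) :
    Filter.Tendsto (fun k => (truncationNum β e k : ℂ) / ((β ^ e k : GaussianInt) : ℂ))
      Filter.atTop (nhds (∑' k, 1 / (β : ℂ) ^ e k)) := by
  have hβ0 : β ≠ 0 := by rintro rfl; norm_num at hβ
  simp_rw [he.truncationNum_div hβ0]
  exact ((he.summable hβ).hasSum.tendsto_sum_nat).comp (Filter.tendsto_add_atTop_nat 1)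

lemma norm_sub_truncation_le (hβ : 2 ≤ ‖(β : ℂ)‖) (k : ℕ) :
    ‖∑' k, 1 / (β : ℂ) ^ e k - (truncationNum β e k : ℂ) / ((β ^ e k : GaussianInt) : ℂ)‖ ≤
      2 / ‖(β : ℂ)‖ ^ e (k + 1) := by
  have hβ0 : β ≠ 0 := by rintro rfl; norm_num at hβ
  rw [he.truncationNum_div hβ0, ← (he.summable hβ).sum_add_tsum_nat_add (k + 1),
    add_sub_cancel_left]
  have h := hasSum_geometric_two.mul_left (1 / ‖(β : ℂ)‖ ^ e (k + 1))
  refine (tsum_of_norm_bounded h fun j => ?_).trans_eq (by ring)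
  rw [add_comm j]
  exact he.norm_one_div_pow_le hβ (k + 1) j

/-- The lattices of all partial sums satisfy the lower bound with the same constant. -/
lemma hyperbolicGap (hβ : 2 ≤ ‖(β : ℂ)‖) {τ : ℝ} (hτ : 2 ≤ τ)
    (heτ : ∀ k, (e (k + 1) : ℝ) ≤ τ * (e k + 1)) :
    ∃ c : ℝ, 0 < c ∧ ∀ k, HyperbolicGap (τ - 2) c (truncationNum β e k) (β ^ e k) := by
  set B := ‖(β : ℂ)‖ with hB
  have hB0 : 0 < B := by linarith
  have hβ0 : β ≠ 0 := by rintro rfl; norm_num [hB] at hβ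
  have hσ : 0 ≤ τ - 2 := by linarith
  have h4 : (0 : ℝ) < 4 ^ (τ - 2) := by positivity
  have hBτ : 0 < B ^ τ := by positivity
  set c := min (1 / (64 * 4 ^ (τ - 2) * B ^ τ)) (1 / (4 * B ^ e 0)) with hc
  have hc0 : 0 < c := lt_min (by positivity) (by positivity)
  refine ⟨c, hc0, fun k => ?_⟩
  induction k with
  | zero =>
    intro q s hq hs _
    have hQ := he.eight_le_norm hβ 0
    have hq1 := one_le_norm_toComplex hq
    have hs1 := one_le_norm_toComplex hs
    have hm : 1 ≤ min ‖(q : ℂ)‖ ‖(s : ℂ)‖ := le_min hq1 hs1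
    have hcQ : c * (4 * ‖((β ^ e 0 : GaussianInt) : ℂ)‖) ≤ 1 := by
      rw [map_pow, norm_pow, ← le_div_iff₀ (by positivity)]
      exact min_le_right _ _
    set Q := ‖((β ^ e 0 : GaussianInt) : ℂ)‖
    set m := min ‖(q : ℂ)‖ ‖(s : ℂ)‖
    have e1 : 4 / Q ≤ 1 := by rw [div_le_one (by linarith)]; linarith
    have e2 : 1 / m ≤ 1 := by rw [div_le_one (by linarith)]; exact hm
    have e3 : m ^ (-(τ - 2)) ≤ 1 := Real.rpow_le_one_of_one_le_of_nonpos hm (by linarith)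
    calc gapWeight (τ - 2) c Q m ≤ c * (1 + 1) * (1 + 1) * 1 * Q := by
          unfold gapWeight; gcongr
      _ = c * (4 * Q) := by ring
      _ ≤ 1 := hcQ
      _ ≤ _ := one_le_mul_of_one_le_of_one_le hq1 hs1
  | succ k ih =>
    have h2 := he.two_mul_le k
    have hnum : truncationNum β e (k + 1) =
        truncationNum β e k * β ^ e k * β ^ (e (k + 1) - 2 * e k) + 1 := by
      rw [truncationNum, mul_assoc, ← pow_add]
      congr 3
      omega
    have hden : β ^ e (k + 1) = (β ^ e k) ^ 2 * β ^ (e (k + 1) - 2 * e k) := by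
      rw [← pow_mul, ← pow_add]
      congr 1
      omega
    rw [hnum, hden]
    refine ih.fold hσ hc0.le (he.isCoprime_truncationNum k) (he.eight_le_norm hβ k)
      (pow_ne_zero _ hβ0) ?_
    rw [map_pow, map_pow, norm_pow, norm_pow, ← hB]
    have h3 : B ^ (e (k + 1) - 2 * e k) ≤ (B ^ e k) ^ (τ - 2) * B ^ τ := by
      rw [← Real.rpow_natCast, ← Real.rpow_natCast, ← Real.rpow_mul hB0.le, ← Real.rpow_add hB0]
      apply Real.rpow_le_rpow_of_exponent_le (by linarith)
      push_cast [Nat.cast_sub h2]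
      linarith [heτ k]
    have h5 : c * (64 * 4 ^ (τ - 2) * B ^ τ) ≤ 1 := by
      rw [← le_div_iff₀ (by positivity)]
      exact min_le_left _ _
    calc 64 * c * 4 ^ (τ - 2) * B ^ (e (k + 1) - 2 * e k)
        ≤ 64 * c * 4 ^ (τ - 2) * ((B ^ e k) ^ (τ - 2) * B ^ τ) := by gcongr
      _ = (c * (64 * 4 ^ (τ - 2) * B ^ τ)) * (B ^ e k) ^ (τ - 2) := by ring
      _ ≤ 1 * (B ^ e k) ^ (τ - 2) := by gcongr
      _ = _ := one_mul _

/-- Rational approximations to the sum of the series have error at least `c / |q| ^ τ`. -/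
lemma exists_le_norm_sub (hβ : 2 ≤ ‖(β : ℂ)‖) {τ : ℝ} (hτ : 2 ≤ τ)
    (heτ : ∀ k, (e (k + 1) : ℝ) ≤ τ * (e k + 1)) :
    ∃ c : ℝ, 0 < c ∧ ∀ p q : GaussianInt, q ≠ 0 →
      c / ‖(q : ℂ)‖ ^ τ ≤ ‖∑' k, 1 / (β : ℂ) ^ e k - (p : ℂ) / (q : ℂ)‖ := by
  obtain ⟨c, hc, hgap⟩ := he.hyperbolicGap hβ hτ heτ
  have hβ0 : β ≠ 0 := by rintro rfl; norm_num at hβ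
  refine ⟨c, hc, fun p q hq => ?_⟩
  have hq1 := one_le_norm_toComplex hq
  have hq0 : 0 < ‖(q : ℂ)‖ := by linarith
  have hlim := ((he.tendsto_truncation hβ).sub_const ((p : ℂ) / (q : ℂ))).norm
  -- The bound for the sum follows from the one for its partial sums with denominator above `|q|`.
  refine ge_of_tendsto hlim ?_
  have hlarge : Filter.Tendsto (fun k => ‖(β : ℂ)‖ ^ e k) Filter.atTop Filter.atTop :=
    (tendsto_pow_atTop_atTop_of_one_lt (by linarith)).comp he.tendsto_atTop
  filter_upwards [hlarge.eventually_gt_atTop ‖(q : ℂ)‖] with k hk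
  have hQ8 := he.eight_le_norm hβ k
  have hk : ‖(q : ℂ)‖ < ‖((β ^ e k : GaussianInt) : ℂ)‖ := by rwa [map_pow, norm_pow]
  have hcop := he.isCoprime_truncationNum (β := β) k
  have hgk := hgap k
  generalize truncationNum β e k = P at *
  have hQ0 : β ^ e k ≠ 0 := pow_ne_zero _ hβ0
  generalize β ^ e k = Q at *
  have hs : q * P - p * Q ≠ 0 := by
    intro h
    have h1 : Q ∣ q * P := ⟨p, by linear_combination h⟩
    exact absurd (norm_toComplex_le_of_dvd hq (hcop.symm.dvd_of_dvd_mul_right h1)) (not_le.2 hk)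
  have h := hgk q _ hq hs ⟨-p, by ring⟩
  set m := min ‖(q : ℂ)‖ ‖((q * P - p * Q : GaussianInt) : ℂ)‖
  have hm1 : 1 ≤ m := le_min hq1 (one_le_norm_toComplex hs)
  have hQpos : 0 < ‖(Q : ℂ)‖ := by linarith
  have hlow : c * ‖(q : ℂ)‖ ^ (-(τ - 2)) * ‖(Q : ℂ)‖ ≤
      ‖(q : ℂ)‖ * ‖((q * P - p * Q : GaussianInt) : ℂ)‖ := by
    refine le_trans ?_ h
    have e3 : ‖(q : ℂ)‖ ^ (-(τ - 2)) ≤ m ^ (-(τ - 2)) :=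
      Real.rpow_le_rpow_of_nonpos (by linarith) (min_le_left _ _) (by linarith)
    have e1 : 0 ≤ 4 / ‖(Q : ℂ)‖ := by positivity
    have e2 : 0 ≤ 1 / m := by positivity
    calc c * ‖(q : ℂ)‖ ^ (-(τ - 2)) * ‖(Q : ℂ)‖
        = c * 1 * 1 * ‖(q : ℂ)‖ ^ (-(τ - 2)) * ‖(Q : ℂ)‖ := by ring
      _ ≤ _ := by
        unfold gapWeight
        gcongr <;> linarith
  have hfrac : ‖(P : ℂ) / (Q : ℂ) - (p : ℂ) / (q : ℂ)‖ =
      ‖((q * P - p * Q : GaussianInt) : ℂ)‖ / (‖(Q : ℂ)‖ * ‖(q : ℂ)‖) := by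
    rw [div_sub_div _ _ (toComplex_ne_zero hQ0) (toComplex_ne_zero hq), norm_div, norm_mul]
    congr 2
    simp
    ring
  have hpow : ‖(q : ℂ)‖ ^ (-(τ - 2)) = ‖(q : ℂ)‖ ^ 2 / ‖(q : ℂ)‖ ^ τ := by
    rw [neg_sub, Real.rpow_sub hq0, Real.rpow_two]
  rw [hpow] at hlow
  rw [hfrac, div_le_div_iff₀ (by positivity) (by positivity)]
  have hqτ : 0 < ‖(q : ℂ)‖ ^ τ := by positivity
  have e5 : c * (‖(q : ℂ)‖ ^ 2 / ‖(q : ℂ)‖ ^ τ) * ‖(Q : ℂ)‖ =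
      ‖(q : ℂ)‖ * (c * (‖(Q : ℂ)‖ * ‖(q : ℂ)‖) / ‖(q : ℂ)‖ ^ τ) := by ring
  rw [e5] at hlow
  have := le_of_mul_le_mul_left hlow hq0
  rwa [div_le_iff₀ hqτ] at this

lemma sum_mem_digitSet (hβ : 2 ≤ ‖(β : ℂ)‖) :
    ∑' k, 1 / (β : ℂ) ^ e k ∈ digitSet (β : ℂ) {0, 1} := by
  classical
  refine ⟨fun j => if j ∈ Set.range (fun k => e k - 1) then 1 else 0, fun j => ?_, ?_⟩
  · by_cases h : j ∈ Set.range (fun k => e k - 1) <;> simp only [h, if_true, if_false] <;> simp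
  · have hinj : Function.Injective (fun k => e k - 1) := fun k l h => by
      have := he.three_le k
      have := he.three_le l
      exact he.strictMono.injective (by dsimp only at h; omega)
    rw [← hinj.hasSum_iff]
    · convert (he.summable hβ).hasSum using 2 with k
      have := he.three_le k
      simp only [Function.comp_apply, Set.mem_range_self, if_true, Nat.cast_one]
      rw [Nat.sub_add_cancel (by omega)]
    · intro j hj
      simp only [if_neg hj, Nat.cast_zero, zero_div]

end IsDoubling

/-! ### Irrationality exponents over `ℚ(i)` -/

lemma not_mem_gaussianRationals_of_le {ξ : ℂ} {τ c : ℝ} (hc : 0 < c)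
    (hlow : ∀ p q : GaussianInt, q ≠ 0 → c / ‖(q : ℂ)‖ ^ τ ≤ ‖ξ - (p : ℂ) / (q : ℂ)‖) :
    ξ ∉ gaussianRationals := by
  rintro ⟨p, q, hq, rfl⟩
  have h := hlow p q hq
  rw [sub_self, norm_zero] at h
  have hq1 := one_le_norm_toComplex hq
  have : 0 < c / ‖(q : ℂ)‖ ^ τ := by positivity
  linarith

lemma le_of_mem_gaussianApproxExponents {ξ : ℂ} {τ c m : ℝ} (hτ : 0 ≤ τ) (hc : 0 < c)
    (hlow : ∀ p q : GaussianInt, q ≠ 0 → c / ‖(q : ℂ)‖ ^ τ ≤ ‖ξ - (p : ℂ) / (q : ℂ)‖)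
    (hm : m ∈ gaussianApproxExponents ξ) : m ≤ τ := by
  by_contra! hτm
  refine hm ?_
  -- The two bounds on the error give `|q| ^ (m - τ) ≤ 1 / c`.
  set R : ℝ := (1 / c) ^ (1 / (m - τ)) with hR
  refine (((finite_norm_toComplex_le (R * (‖ξ‖ + 1))).prod
    (finite_norm_toComplex_le R)).image fun z => (z.1 : ℂ) / (z.2 : ℂ)).subset ?_
  rintro _ ⟨p, q, hq, rfl, h⟩
  have hq1 := one_le_norm_toComplex hq
  have hq0 : 0 < ‖(q : ℂ)‖ := by linarith
  have hqR : ‖(q : ℂ)‖ ≤ R := by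
    have h1 := (hlow p q hq).trans_lt h
    rw [div_lt_div_iff₀ (by positivity) (by positivity), one_mul] at h1
    have h2 : ‖(q : ℂ)‖ ^ (m - τ) ≤ 1 / c := by
      rw [Real.rpow_sub hq0, div_le_div_iff₀ (by positivity) hc, one_mul, mul_comm]
      exact h1.le
    have h3 := Real.rpow_le_rpow (by positivity) h2
      (show 0 ≤ 1 / (m - τ) from one_div_nonneg.2 (by linarith))
    rwa [← Real.rpow_mul hq0.le, mul_one_div_cancel (by linarith), Real.rpow_one] at h3
  refine ⟨(p, q), ⟨?_, hqR⟩, rfl⟩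
  have h1 : ‖(p : ℂ) / (q : ℂ)‖ ≤ ‖ξ‖ + 1 := by
    have h4 : 1 / ‖(q : ℂ)‖ ^ m ≤ 1 := by
      rw [div_le_one (by positivity)]
      exact Real.one_le_rpow hq1 (by linarith)
    have h5 := norm_sub_le ξ (ξ - (p : ℂ) / (q : ℂ))
    rw [sub_sub_cancel] at h5
    linarith
  rw [norm_div, div_le_iff₀ hq0] at h1
  calc ‖(p : ℂ)‖ ≤ (‖ξ‖ + 1) * ‖(q : ℂ)‖ := h1
    _ ≤ (‖ξ‖ + 1) * R := by gcongr
    _ = R * (‖ξ‖ + 1) := mul_comm _ _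

/-- Fractions converging to `ξ` take infinitely many values if `ξ` is not a value itself. -/
lemma mem_gaussianApproxExponents_of_tendsto {ξ : ℂ} {m : ℝ} (hξ : ξ ∉ gaussianRationals)
    {P Q : ℕ → GaussianInt} (hQ : ∀ k, Q k ≠ 0)
    (hlim : Filter.Tendsto (fun k => (P k : ℂ) / (Q k : ℂ)) Filter.atTop (nhds ξ))
    (happ : ∀ᶠ k in Filter.atTop,
      ‖ξ - (P k : ℂ) / (Q k : ℂ)‖ < 1 / ‖(Q k : ℂ)‖ ^ m) :
    m ∈ gaussianApproxExponents ξ := by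
  intro hfin
  have hξS : ξ ∉ {z : ℂ | ∃ p q : GaussianInt, q ≠ 0 ∧ z = (p : ℂ) / (q : ℂ) ∧
      ‖ξ - (p : ℂ) / (q : ℂ)‖ < 1 / ‖(q : ℂ)‖ ^ m} := by
    rintro ⟨p, q, hq, h, -⟩
    exact hξ ⟨p, q, hq, h⟩
  have hout := hlim.eventually (hfin.isClosed.isOpen_compl.mem_nhds hξS)
  obtain ⟨k, h1, h2⟩ := (hout.and happ).exists
  exact h1 ⟨P k, Q k, hQ k, rfl, h2⟩

lemma IsDoubling.gaussianIrrationalityExponent_eq {e : ℕ → ℕ} (he : IsDoubling e)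
    {β : GaussianInt} (hβ : 2 ≤ ‖(β : ℂ)‖) {τ : ℝ} (hτ : 2 ≤ τ)
    (heτ : ∀ k, (e (k + 1) : ℝ) ≤ τ * (e k + 1)) (heτ' : ∀ k, τ * e k - 1 ≤ (e (k + 1) : ℝ)) :
    gaussianIrrationalityExponent (∑' k, 1 / (β : ℂ) ^ e k) = (τ : EReal) := by
  obtain ⟨c, hc, hlow⟩ := he.exists_le_norm_sub hβ hτ heτ
  have hβ0 : β ≠ 0 := by rintro rfl; norm_num at hβ
  set B := ‖(β : ℂ)‖ with hB
  have hB0 : 0 < B := by linarith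
  apply le_antisymm
  · apply sSup_le
    rintro _ ⟨m, hm, rfl⟩
    exact EReal.coe_le_coe_iff.2 (le_of_mem_gaussianApproxExponents (by linarith) hc hlow hm)
  · refine EReal.ge_of_forall_gt_iff_ge.1 fun m hm => le_sSup ⟨m, ?_, rfl⟩
    have hm : 0 < τ - m := sub_pos.2 (EReal.coe_lt_coe_iff.1 hm)
    refine mem_gaussianApproxExponents_of_tendsto (not_mem_gaussianRationals_of_le hc hlow)
      (fun k => pow_ne_zero (e k) hβ0) (he.tendsto_truncation hβ) ?_
    have hinf : Filter.Tendsto (fun k => (τ - m) * (e k : ℝ)) Filter.atTop Filter.atTop :=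
      (tendsto_natCast_atTop_atTop.comp he.tendsto_atTop).const_mul_atTop hm
    filter_upwards [hinf.eventually_gt_atTop 2] with k hk
    refine (he.norm_sub_truncation_le hβ k).trans_lt ?_
    rw [map_pow, norm_pow, ← hB, ← Real.rpow_natCast, ← Real.rpow_natCast,
      ← Real.rpow_mul hB0.le, div_lt_div_iff₀ (by positivity) (by positivity), one_mul]
    calc 2 * B ^ (e k * m : ℝ) ≤ B ^ (1 : ℝ) * B ^ (e k * m : ℝ) := by
          rw [Real.rpow_one]; gcongr
      _ = B ^ (1 + e k * m : ℝ) := (Real.rpow_add hB0 _ _).symm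
      _ < B ^ (e (k + 1) : ℝ) := by
          apply Real.rpow_lt_rpow_of_exponent_lt (by linarith)
          linarith [heτ' k]

/-! ### The exponents `⌊λ τ ^ n⌋` -/

lemma three_lt_of_startIndex_le {b : ℂ} {τ lam : ℝ} (hτ : 2 ≤ τ) (hlam : 0 < lam) {n : ℕ}
    (hn : startIndex b τ lam ≤ n) : 3 < lam * τ ^ n := by
  have hlog : 0 < Real.log τ := Real.log_pos (by linarith)
  have h1 : Real.log (3 / lam) / Real.log τ < n := by
    calc Real.log (3 / lam) / Real.log τ
        < ⌊Real.log (3 / lam) / Real.log τ⌋ + 1 := Int.lt_floor_add_one _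
      _ ≤ startIndex b τ lam := by
        unfold startIndex
        rw [add_comm]
        gcongr
        exact (le_max_right _ _).trans (le_max_left _ _)
      _ ≤ n := hn
  rw [div_lt_iff₀ hlog, ← Real.log_pow, Real.log_lt_log_iff (by positivity) (by positivity),
    div_lt_iff₀ hlam] at h1
  linarith

lemma isDoubling_floor {τ lam : ℝ} {N : ℕ} (hτ : 2 ≤ τ) (hlam : 0 < lam)
    (hN : 3 < lam * τ ^ N) : IsDoubling fun k => ⌊lam * τ ^ (N + k)⌋₊ where
  three_le_zero := Nat.le_floor (by simpa using hN.le)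
  two_mul_le k := by
    apply Nat.le_floor
    have h := Nat.floor_le (show 0 ≤ lam * τ ^ (N + k) by positivity)
    have h0 : 0 ≤ lam * τ ^ (N + k) := by positivity
    rw [← add_assoc, pow_succ]
    push_cast
    nlinarith

/-- The natural numbers `n ≥ n₀`, counted from the least one, `⌈n₀⌉`. -/
noncomputable def startEquiv (b : ℂ) (τ lam : ℝ) :
    ℕ ≃ {n : ℕ // startIndex b τ lam ≤ (n : ℝ)} where
  toFun k := ⟨⌈startIndex b τ lam⌉₊ + k, Nat.ceil_le.1 (Nat.le_add_right _ _)⟩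
  invFun n := n - ⌈startIndex b τ lam⌉₊
  left_inv k := by simp
  right_inv n := Subtype.ext (Nat.add_sub_cancel' (Nat.ceil_le.2 n.2))

theorem theorem2 (A : ℕ) (hA : 2 ≤ A) (b : ℂ)
    (hb : b = -(A : ℂ) + Complex.I ∨ b = -(A : ℂ) - Complex.I)
    (τ lam : ℝ) (hτ : 2 ≤ τ) (hlam : 0 < lam) :
    Summable (lacunaryTerm b τ lam) ∧
      lacunaryNumber b τ lam ∈ digitSet b {0, 1} ∧
      lacunaryNumber b τ lam ∉ gaussianRationals ∧
      gaussianIrrationalityExponent (lacunaryNumber b τ lam) = (τ : EReal) ∧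
      (τ = 2 → GaussianBadlyApproximable (lacunaryNumber b τ lam)) := by
  obtain ⟨β, rfl⟩ : ∃ β : GaussianInt, (β : ℂ) = b := by
    rcases hb with rfl | rfl
    · exact ⟨⟨-A, 1⟩, by simp [GaussianInt.toComplex_def']⟩
    · exact ⟨⟨-A, -1⟩, by simp [GaussianInt.toComplex_def', sub_eq_add_neg]⟩
  have hβ : 2 ≤ ‖(β : ℂ)‖ := by
    have hre : |(β : ℂ).re| = A := by
      rcases hb with h | h <;> rw [h] <;> simp
    have hA' : (2 : ℝ) ≤ A := by exact_mod_cast hA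
    exact (hA'.trans_eq hre.symm).trans (Complex.abs_re_le_norm _)
  set N := ⌈startIndex (β : ℂ) τ lam⌉₊
  set e : ℕ → ℕ := fun k => ⌊lam * τ ^ (N + k)⌋₊ with hedef
  have he : IsDoubling e :=
    isDoubling_floor hτ hlam (three_lt_of_startIndex_le hτ hlam (Nat.le_ceil _))
  have hbounds : ∀ k, (e (k + 1) : ℝ) ≤ τ * (e k + 1) ∧ τ * e k - 1 ≤ (e (k + 1) : ℝ) := by
    intro k
    have hpos : ∀ j, 0 ≤ lam * τ ^ (N + j) := fun j => by positivity
    have h1 := Nat.floor_le (hpos k)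
    have h2 := Nat.lt_floor_add_one (lam * τ ^ (N + k))
    have h3 := Nat.floor_le (hpos (k + 1))
    have h4 := Nat.lt_floor_add_one (lam * τ ^ (N + (k + 1)))
    have h5 : lam * τ ^ (N + (k + 1)) = τ * (lam * τ ^ (N + k)) := by ring
    simp only [hedef]
    rw [h5] at h3 h4 ⊢
    constructor <;> nlinarith
  have hterm : lacunaryTerm (β : ℂ) τ lam ∘ startEquiv (β : ℂ) τ lam =
      fun k => 1 / (β : ℂ) ^ e k := rfl
  have hξ : lacunaryNumber (β : ℂ) τ lam = ∑' k, 1 / (β : ℂ) ^ e k :=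
    ((startEquiv (β : ℂ) τ lam).tsum_eq (lacunaryTerm (β : ℂ) τ lam)).symm
  have hsum : Summable (lacunaryTerm (β : ℂ) τ lam) := by
    rw [← (startEquiv (β : ℂ) τ lam).summable_iff, hterm]
    exact he.summable hβ
  obtain ⟨c, hc, hlow⟩ := he.exists_le_norm_sub hβ hτ fun k => (hbounds k).1
  have hirr := not_mem_gaussianRationals_of_le hc hlow
  rw [hξ]
  refine ⟨hsum, he.sum_mem_digitSet hβ, hirr, he.gaussianIrrationalityExponent_eq hβ hτ
    (fun k => (hbounds k).1) (fun k => (hbounds k).2), ?_⟩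
  rintro rfl
  exact ⟨hirr, c, hc, fun p q hq => by simpa only [Real.rpow_two] using hlow p q hq⟩
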